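/- Let $\Omega\subset\mathbb R^n$ be closed and convex (for instance $\Omega=[-1,1]^n$ or $\Omega=\mathbb R^n$), let $S\subset\Omega$ be Borel measurable and countably $1$-rectifiable (i.e. $S=\bigcup_{i\in\mathbb N} f_i(A_i)$ with $A_i\subset\mathbb R$ bounded and $f_i:A_i\to\mathbb R^n$ Lipschitz), let $a\in[0,\infty]$, and let $b:S\to[0,a]$ be lower semi-continuous. For $x,y\in\Omega$ define the generalized urban metric $$d_{S,a,b}(x,y)=\inf_{\gamma}\left(\int_{\gamma([0,1])\cap S}b\,\mathrm d\mathcal H^1+a\,\mathcal H^1(\gamma([0,1])\setminus S)\right)\in[0,\infty],$$ where $\mathcal H^1$ is the one-dimensional Hausdorff measure, $\infty\cdot 0=0$, and the infimum is over all Lipschitz paths $\gamma:[0,1]\to\Omega$ with $\gamma(0)=x$, $\gamma(1)=y$. If $a<\infty$, then $d_{S,a,b}:\Omega\times\Omega\to[0,\infty]$ is continuous. If $a=\infty$ and $\mathcal H^1(\{z\in S: b(z)\le\lambda\})<\infty$ for all $\lambda\in[0,\infty)$, then $d_{S,a,b}:\Omega\times\Omega\to[0,\infty]$ is lower semi-continuous.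 -/

import Mathlib

open Set MeasureTheory
open scoped ENNReal NNReal

/-- `S` is countably `1`-rectifiable: a countable union of Lipschitz images of bounded subsets
of the line (the sets `A i` may be empty). -/
def IsCountablyOneRectifiable {n : ℕ} (S : Set (EuclideanSpace ℝ (Fin n))) : Prop :=
  ∃ (A : ℕ → Set ℝ) (f : ℕ → ℝ → EuclideanSpace ℝ (Fin n)),
    (∀ i, Bornology.IsBounded (A i)) ∧
    (∀ i, ∃ K : ℝ≥0, LipschitzOnWith K (f i) (A i)) ∧
    S = ⋃ i, f i '' A i

/-- The Lipschitz paths `γ : [0,1] → Ω` with `γ 0 = x` and `γ 1 = y`. -/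
def lipschitzPaths {n : ℕ} (Ω : Set (EuclideanSpace ℝ (Fin n)))
    (x y : EuclideanSpace ℝ (Fin n)) : Set (unitInterval → EuclideanSpace ℝ (Fin n)) :=
  {γ | (∃ K : ℝ≥0, LipschitzWith K γ) ∧ (∀ t, γ t ∈ Ω) ∧ γ 0 = x ∧ γ 1 = y}

/-- The cost of a set `T` (the image of a path): the integral of `b` over `T ∩ S` with respect to
the one-dimensional Hausdorff measure plus `a` times the Hausdorff measure of `T \ S`
(with `∞ * 0 = 0`). Only the values of `b` on `S` matter. -/
noncomputable def travelCost {n : ℕ} (S : Set (EuclideanSpace ℝ (Fin n))) (a : ℝ≥0∞)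
    (b : EuclideanSpace ℝ (Fin n) → ℝ≥0∞) (T : Set (EuclideanSpace ℝ (Fin n))) : ℝ≥0∞ :=
  (∫⁻ z in T ∩ S, b z ∂(Measure.hausdorffMeasure 1)) + a * Measure.hausdorffMeasure 1 (T \ S)

/-- The generalized urban metric `d_{S,a,b}`, with paths running in `Ω`. -/
noncomputable def urbanMetric {n : ℕ} (Ω S : Set (EuclideanSpace ℝ (Fin n))) (a : ℝ≥0∞)
    (b : EuclideanSpace ℝ (Fin n) → ℝ≥0∞) (x y : EuclideanSpace ℝ (Fin n)) : ℝ≥0∞ :=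
  ⨅ γ ∈ lipschitzPaths Ω x y, travelCost S a b (range γ)

/-- The sublevel sets `{z ∈ S | b z ≤ l}` have finite one-dimensional Hausdorff measure for all
`l ∈ [0, a)`. -/
def FiniteSublevels {n : ℕ} (S : Set (EuclideanSpace ℝ (Fin n))) (a : ℝ≥0∞)
    (b : EuclideanSpace ℝ (Fin n) → ℝ≥0∞) : Prop :=
  ∀ l : ℝ≥0∞, l < a → Measure.hausdorffMeasure 1 {z ∈ S | b z ≤ l} < ∞

open Filter Topology

/-! ### Lipschitz paths on the unit interval -/

section Paths

variable {X : Type*}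

/-- The extension of a map on the unit interval to the line that is constant on both sides. -/
noncomputable def lineExtend (γ : unitInterval → X) (r : ℝ) : X := γ (projIcc 0 1 zero_le_one r)

theorem lineExtend_coe (γ : unitInterval → X) (u : unitInterval) : lineExtend γ u = γ u := by
  simp [lineExtend]

theorem lineExtend_mem_range (γ : unitInterval → X) (r : ℝ) : lineExtend γ r ∈ range γ :=
  mem_range_self _

variable [MetricSpace X]

/-- Two Lipschitz maps on the line that agree at `s` can be glued at `s`, with the same constant. -/
theorem LipschitzWith.ite_le {K : ℝ≥0} {f g : ℝ → X} {s : ℝ} (hf : LipschitzWith K f)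
    (hg : LipschitzWith K g) (hfg : f s = g s) :
    LipschitzWith K (fun r => if r ≤ s then f r else g r) := by
  have key : ∀ u v : ℝ, u ≤ s → s < v → dist (f u) (g v) ≤ K * dist u v := by
    intro u v hu hv
    calc dist (f u) (g v) ≤ dist (f u) (f s) + dist (f s) (g v) := dist_triangle _ _ _
      _ ≤ K * dist u s + K * dist s v := by
        rw [hfg]
        nth_rewrite 1 [← hfg]
        exact add_le_add (hf.dist_le_mul _ _) (hg.dist_le_mul _ _)
      _ = K * dist u v := by
        rw [← mul_add, Real.dist_eq, Real.dist_eq, Real.dist_eq, abs_of_nonpos (by linarith),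
          abs_of_neg (by linarith), abs_of_neg (by linarith)]
        ring
  refine LipschitzWith.of_dist_le_mul fun u v => ?_
  split_ifs with hu hv hv
  · exact hf.dist_le_mul _ _
  · exact key u v hu (not_le.1 hv)
  · rw [dist_comm, dist_comm u]
    exact key v u hv (not_le.1 hu)
  · exact hg.dist_le_mul _ _

theorem LipschitzWith.lineExtend {K : ℝ≥0} {γ : unitInterval → X} (h : LipschitzWith K γ) :
    LipschitzWith K (lineExtend γ) := by
  have := h.comp (LipschitzWith.projIcc (zero_le_one (α := ℝ)))
  rwa [mul_one] at this

theorem LipschitzWith.comp_const_mul {K : ℝ≥0} {F : ℝ → X} (h : LipschitzWith K F) (c : ℝ≥0) :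
    LipschitzWith (K * c) (fun u : unitInterval => F (c * u)) := by
  refine LipschitzWith.of_dist_le_mul fun u v => (h.dist_le_mul _ _).trans (le_of_eq ?_)
  rw [Real.dist_eq, ← mul_sub, abs_mul, NNReal.abs_eq, Subtype.dist_eq, Real.dist_eq]
  push_cast
  ring

/-- Concatenation of Lipschitz paths. -/
theorem exists_lipschitz_concat {K₁ K₂ : ℝ≥0} {γ₁ γ₂ : unitInterval → X}
    (h₁ : LipschitzWith K₁ γ₁) (h₂ : LipschitzWith K₂ γ₂) (h : γ₁ 1 = γ₂ 0) :
    ∃ γ : unitInterval → X, (∃ K, LipschitzWith K γ) ∧ γ 0 = γ₁ 0 ∧ γ 1 = γ₂ 1 ∧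
      range γ ⊆ range γ₁ ∪ range γ₂ := by
  have hs : LipschitzWith 1 (fun r : ℝ => r - 1) :=
    LipschitzWith.of_dist_le_mul fun u v => by simp
  have hF := LipschitzWith.ite_le (s := 1) (h₁.lineExtend.weaken (le_max_left K₁ K₂))
    (((h₂.lineExtend.weaken (le_max_right K₁ K₂)).comp hs).weaken (mul_one _).le)
    (by simpa [lineExtend] using h)
  refine ⟨_, ⟨_, hF.comp_const_mul 2⟩, ?_, ?_, ?_⟩
  · simp [lineExtend]
  · have : ¬ ((2 : ℝ) ≤ 1) := by norm_num
    have h21 : (2 : ℝ) - 1 = 1 := by norm_num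
    simp [lineExtend, this, h21]
  · rintro _ ⟨u, rfl⟩
    dsimp only
    split_ifs
    · exact Or.inl (lineExtend_mem_range _ _)
    · exact Or.inr (lineExtend_mem_range _ _)

/-- A loop can be cut out of a Lipschitz path, which improves the Lipschitz constant. -/
theorem exists_lipschitz_cut {K : ℝ≥0} {γ : unitInterval → X} (h : LipschitzWith K γ)
    {s t : unitInterval} (hst : s < t) (hγ : γ s = γ t) :
    ∃ (c : ℝ≥0) (η : unitInterval → X), c < 1 ∧ LipschitzWith (K * c) η ∧ η 0 = γ 0 ∧ η 1 = γ 1 ∧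
      range η ⊆ range γ := by
  have hst' : (s : ℝ) < t := hst
  have hs0 := s.2.1
  have ht1 := t.2.2
  have hs : LipschitzWith 1 (fun r : ℝ => r + (t - s)) :=
    LipschitzWith.of_dist_le_mul fun u v => by simp
  have hF := LipschitzWith.ite_le (s := s) h.lineExtend
    ((h.lineExtend.comp hs).weaken (mul_one _).le)
    (by
      have : (s : ℝ) + (t - s) = t := by ring
      simp only [Function.comp, this, lineExtend_coe, hγ])
  obtain ⟨c, hc⟩ : ∃ c : ℝ≥0, (c : ℝ) = 1 - (t - s) := ⟨⟨1 - (t - s), by linarith⟩, rfl⟩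
  refine ⟨c, _, ?_, hF.comp_const_mul c, ?_, ?_, ?_⟩
  · rw [← NNReal.coe_lt_coe, hc, NNReal.coe_one]
    linarith
  · simp [lineExtend, hs0]
  · simp only [Icc.coe_one, mul_one, Function.comp, hc]
    split_ifs with hc'
    · have h1 : t = 1 := Subtype.ext (by change (t : ℝ) = 1; linarith)
      have h2 : (1 : ℝ) - (t - s) = s := by simp [h1]
      rw [h2, lineExtend_coe, hγ, h1]
    · have h2 : (1 : ℝ) - (t - s) + (t - s) = (1 : unitInterval) := by simp
      rw [h2, lineExtend_coe]
  · rintro _ ⟨u, rfl⟩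
    dsimp only
    split_ifs
    · exact lineExtend_mem_range _ _
    · exact lineExtend_mem_range _ _

end Paths

/-! ### One-dimensional Hausdorff measure of Lipschitz images -/

section Hausdorff

variable {X : Type*} [MetricSpace X] [MeasurableSpace X] [BorelSpace X]

theorem hausdorffMeasure_unitInterval_univ :
    Measure.hausdorffMeasure 1 (univ : Set unitInterval) = 1 := by
  have := (isometry_subtype_coe (s := unitInterval)).hausdorffMeasure_image
    (d := 1) (Or.inl zero_le_one) univ
  rw [← this, image_univ, Subtype.range_coe, hausdorffMeasure_real]
  simp [unitInterval]

instance : IsProbabilityMeasure (Measure.hausdorffMeasure 1 : Measure unitInterval) :=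
  ⟨hausdorffMeasure_unitInterval_univ⟩

theorem hausdorffMeasure_unitInterval_Icc {s t : unitInterval} (h : s ≤ t) :
    Measure.hausdorffMeasure 1 (Icc s t) = edist s t := by
  have := (isometry_subtype_coe (s := unitInterval)).hausdorffMeasure_image
    (d := 1) (Or.inl zero_le_one) (Icc s t)
  have him : (Subtype.val '' Icc s t : Set ℝ) = Icc (s : ℝ) t := by
    ext r
    constructor
    · rintro ⟨u, hu, rfl⟩
      exact hu
    · intro hr
      exact ⟨⟨r, s.2.1.trans hr.1, hr.2.trans t.2.2⟩, hr, rfl⟩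
  rw [← this, him, hausdorffMeasure_real, Real.volume_Icc, Subtype.edist_eq, edist_dist,
    dist_comm, Real.dist_eq, abs_of_nonneg (sub_nonneg.2 (Subtype.coe_le_coe.2 h))]

theorem LipschitzWith.hausdorffMeasure_one_image_le {Y : Type*} [MetricSpace Y]
    [MeasurableSpace Y] [BorelSpace Y] {K : ℝ≥0} {f : Y → X} (h : LipschitzWith K f) (s : Set Y) :
    Measure.hausdorffMeasure 1 (f '' s) ≤ K * Measure.hausdorffMeasure 1 s := by
  simpa using h.hausdorffMeasure_image_le zero_le_one s

theorem LipschitzWith.hausdorffMeasure_one_range_le {K : ℝ≥0} {γ : unitInterval → X}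
    (h : LipschitzWith K γ) : Measure.hausdorffMeasure 1 (range γ) ≤ K := by
  have := h.hausdorffMeasure_one_image_le univ
  rwa [image_univ, hausdorffMeasure_unitInterval_univ, mul_one] at this

/-- A connected set has one-dimensional Hausdorff measure at least the distance of any two of its
points. -/
theorem IsPreconnected.edist_le_hausdorffMeasure {T : Set X} (hT : IsPreconnected T) {x y : X}
    (hx : x ∈ T) (hy : y ∈ T) : edist x y ≤ Measure.hausdorffMeasure 1 T := by
  have hl : LipschitzWith 1 (fun z => dist x z) := LipschitzWith.dist_right x
  have h1 := hl.hausdorffMeasure_one_image_le T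
  have h2 : Icc 0 (dist x y) ⊆ (fun z => dist x z) '' T := by
    have := (hT.image _ hl.continuous.continuousOn).Icc_subset (mem_image_of_mem _ hx)
      (mem_image_of_mem _ hy)
    simpa using this
  calc edist x y = volume (Icc 0 (dist x y)) := by rw [Real.volume_Icc, sub_zero, edist_dist]
    _ = Measure.hausdorffMeasure 1 (Icc 0 (dist x y)) := by rw [hausdorffMeasure_real]
    _ ≤ _ := measure_mono h2
    _ ≤ _ := h1
    _ = _ := by simp

end Hausdorff

/-! ### The case of finite `a` -/

section FiniteCost

variable {n : ℕ} {Ω S : Set (EuclideanSpace ℝ (Fin n))} {a : ℝ≥0∞}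
  {b : EuclideanSpace ℝ (Fin n) → ℝ≥0∞}

theorem travelCost_mono {T T' : Set (EuclideanSpace ℝ (Fin n))} (h : T ⊆ T') :
    travelCost S a b T ≤ travelCost S a b T' := by
  unfold travelCost
  gcongr

theorem travelCost_union_le (T T' : Set (EuclideanSpace ℝ (Fin n))) :
    travelCost S a b (T ∪ T') ≤ travelCost S a b T + travelCost S a b T' := by
  unfold travelCost
  calc _ ≤ (∫⁻ z in T ∩ S, b z ∂(Measure.hausdorffMeasure 1)
          + ∫⁻ z in T' ∩ S, b z ∂(Measure.hausdorffMeasure 1))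
        + a * (Measure.hausdorffMeasure 1 (T \ S) + Measure.hausdorffMeasure 1 (T' \ S)) := by
        rw [union_inter_distrib_right, union_sdiff_distrib]
        gcongr
        · exact lintegral_union_le _ _ _
        · exact measure_union_le _ _
    _ = _ := by ring

theorem travelCost_le_mul (hS : MeasurableSet S) (hba : ∀ z ∈ S, b z ≤ a)
    {T : Set (EuclideanSpace ℝ (Fin n))} (hT : MeasurableSet T) :
    travelCost S a b T ≤ a * Measure.hausdorffMeasure 1 T := by
  unfold travelCost
  rw [← measure_inter_add_sdiff T hS, mul_add]
  gcongr
  calc _ ≤ ∫⁻ _ in T ∩ S, a ∂(Measure.hausdorffMeasure 1) :=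
        setLIntegral_mono' (hT.inter hS) fun z hz => hba z hz.2
    _ = _ := by rw [setLIntegral_const]

theorem urbanMetric_triangle (x y z : EuclideanSpace ℝ (Fin n)) :
    urbanMetric Ω S a b x z ≤ urbanMetric Ω S a b x y + urbanMetric Ω S a b y z := by
  unfold urbanMetric
  simp only [ENNReal.iInf_add, ENNReal.add_iInf, le_iInf_iff]
  rintro γ₂ ⟨⟨K₂, h₂⟩, hΩ₂, h₂0, h₂1⟩ γ₁ ⟨⟨K₁, h₁⟩, hΩ₁, h₁0, h₁1⟩
  obtain ⟨γ, hL, h0, h1, hr⟩ := exists_lipschitz_concat h₁ h₂ (h₁1.trans h₂0.symm)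
  refine (iInf₂_le γ ⟨hL, fun t => ?_, h0.trans h₁0, h1.trans h₂1⟩).trans
    ((travelCost_mono hr).trans (travelCost_union_le _ _))
  rcases hr (mem_range_self t) with ⟨u, hu⟩ | ⟨u, hu⟩
  · exact hu ▸ hΩ₁ u
  · exact hu ▸ hΩ₂ u

theorem urbanMetric_le_mul_edist (hΩ : Convex ℝ Ω) (hS : MeasurableSet S)
    (hba : ∀ z ∈ S, b z ≤ a) {x y : EuclideanSpace ℝ (Fin n)} (hx : x ∈ Ω) (hy : y ∈ Ω) :
    urbanMetric Ω S a b x y ≤ a * edist x y := by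
  have hL : LipschitzWith (nndist x y)
      (fun t : unitInterval => AffineMap.lineMap (k := ℝ) x y (t : ℝ)) := by
    simpa using! (lipschitzWith_lineMap (𝕜 := ℝ) x y).comp (LipschitzWith.subtype_val unitInterval)
  refine (iInf₂_le (fun t : unitInterval => AffineMap.lineMap (k := ℝ) x y (t : ℝ))
    ⟨⟨_, hL⟩, fun t => hΩ.lineMap_mem hx hy t.2, by simp, by simp⟩).trans
    ((travelCost_le_mul hS hba (isCompact_range hL.continuous).measurableSet).trans ?_)
  gcongr
  rw [edist_nndist]
  exact hL.hausdorffMeasure_one_range_le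

theorem continuousOn_urbanMetric (hΩ : Convex ℝ Ω) (hS : MeasurableSet S)
    (hba : ∀ z ∈ S, b z ≤ a) (ha : a < ∞) :
    ContinuousOn
      (fun p : EuclideanSpace ℝ (Fin n) × EuclideanSpace ℝ (Fin n) =>
        urbanMetric Ω S a b p.1 p.2) (Ω ×ˢ Ω) := by
  rw [continuousOn_iff_continuous_domRestrict]
  refine continuous_of_le_add_edist (a * 2) (ENNReal.mul_ne_top ha.ne (by simp)) ?_
  rintro ⟨⟨x, y⟩, hx, hy⟩ ⟨⟨x', y'⟩, hx', hy'⟩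
  have e1 : edist x x' ≤ edist (x, y) (x', y') := le_max_left _ _
  have e2 : edist y' y ≤ edist (x, y) (x', y') := by
    rw [edist_comm y' y]
    exact le_max_right _ _
  calc urbanMetric Ω S a b x y
      ≤ urbanMetric Ω S a b x x' + (urbanMetric Ω S a b x' y' + urbanMetric Ω S a b y' y) :=
        (urbanMetric_triangle x x' y).trans (by gcongr; exact urbanMetric_triangle _ _ _)
    _ ≤ a * edist (x, y) (x', y')
        + (urbanMetric Ω S a b x' y' + a * edist (x, y) (x', y')) := by
        gcongr
        · exact (urbanMetric_le_mul_edist hΩ hS hba hx hx').trans (by gcongr)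
        · exact (urbanMetric_le_mul_edist hΩ hS hba hy' hy).trans (by gcongr)
    _ = urbanMetric Ω S a b x' y' + a * 2 * edist (x, y) (x', y') := by ring

end FiniteCost

/-! ### Compactness of Lipschitz paths and paths parametrized by length -/

section Compactness

variable {X : Type*} [MetricSpace X]

theorem exists_subseq_tendstoUniformly_lipschitzWith {s : Set X} (hs : IsCompact s) {L : ℝ≥0}
    {l : ℕ → ℝ≥0} (hl : ∀ k, l k ≤ L) {γ : ℕ → unitInterval → X}
    (hγ : ∀ k, LipschitzWith (l k) (γ k)) (hγs : ∀ k t, γ k t ∈ s) :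
    ∃ (φ : ℕ → ℕ) (l₀ : ℝ≥0) (γ₀ : unitInterval → X), StrictMono φ ∧
      Tendsto (l ∘ φ) atTop (𝓝 l₀) ∧ LipschitzWith l₀ γ₀ ∧
      TendstoUniformly (fun k => γ (φ k)) γ₀ atTop := by
  let F : ℕ → BoundedContinuousFunction unitInterval X := fun k =>
    BoundedContinuousFunction.mkOfCompact ⟨γ k, (hγ k).continuous⟩
  have hF : ∀ k t, F k t = γ k t := fun _ _ => rfl
  have hequi : Equicontinuous ((↑) : range F → unitInterval → X) := by
    apply UniformEquicontinuous.equicontinuous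
    refine LipschitzWith.uniformEquicontinuous _ L ?_
    rintro ⟨_, k, rfl⟩
    exact (hγ k).weaken (hl k)
  have hcomp := BoundedContinuousFunction.arzela_ascoli s hs (range F)
    (by rintro _ t ⟨k, rfl⟩; exact hγs k t) hequi
  obtain ⟨⟨l₀, f⟩, -, φ, hφ, hlim⟩ := ((isCompact_Icc (a := (0 : ℝ≥0)) (b := L)).prod
    hcomp).tendsto_subseq (x := fun k => (l k, F k))
    (fun k => ⟨⟨zero_le, hl k⟩, subset_closure (mem_range_self k)⟩)
  have h1 : Tendsto (l ∘ φ) atTop (𝓝 l₀) := (continuous_fst.tendsto _).comp hlim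
  have h2 : Tendsto (fun k => F (φ k)) atTop (𝓝 f) := (continuous_snd.tendsto _).comp hlim
  have h3 := BoundedContinuousFunction.tendsto_iff_tendstoUniformly.1 h2
  refine ⟨φ, l₀, f, hφ, h1, ?_, h3⟩
  refine LipschitzWith.of_dist_le_mul fun u v => ?_
  exact le_of_tendsto_of_tendsto' ((h3.tendsto_at u).dist (h3.tendsto_at v))
    ((NNReal.continuous_coe.tendsto _).comp h1 |>.mul_const _)
    fun k => (hγ (φ k)).dist_le_mul u v

/-- Inside a compact set that contains a Lipschitz path from `x` to `y`, there is an injective one,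
unless `x = y`. -/
theorem exists_injective_lipschitzWith {K : Set X} (hK : IsCompact K) {C : ℝ≥0}
    {γ : unitInterval → X} (hγ : LipschitzWith C γ) (hγK : range γ ⊆ K) (hne : γ 0 ≠ γ 1) :
    ∃ (D : ℝ≥0) (η : unitInterval → X), LipschitzWith D η ∧ η 0 = γ 0 ∧ η 1 = γ 1 ∧
      range η ⊆ K ∧ Function.Injective η := by
  let A : Set ℝ≥0 := {D | ∃ η : unitInterval → X, LipschitzWith D η ∧ η 0 = γ 0 ∧ η 1 = γ 1 ∧
    range η ⊆ K}
  have hA : A.Nonempty := ⟨C, γ, hγ, rfl, rfl, hγK⟩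
  obtain ⟨l, hanti, hlim, hlA⟩ := exists_seq_tendsto_sInf hA (OrderBot.bddBelow A)
  choose g hgL hg0 hg1 hgK using hlA
  obtain ⟨φ, l₀, η, hφ, hl₀, hη, hu⟩ := exists_subseq_tendstoUniformly_lipschitzWith hK
    (fun k => hanti (Nat.zero_le k)) hgL (fun k t => hgK k (mem_range_self t))
  have hmin : l₀ = sInf A := tendsto_nhds_unique hl₀ (hlim.comp hφ.tendsto_atTop)
  have h0 : η 0 = γ 0 := tendsto_nhds_unique (hu.tendsto_at 0) (by simp [hg0])
  have h1 : η 1 = γ 1 := tendsto_nhds_unique (hu.tendsto_at 1) (by simp [hg1])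
  have hηK : range η ⊆ K := by
    rintro _ ⟨t, rfl⟩
    exact hK.isClosed.mem_of_tendsto (hu.tendsto_at t)
      (Eventually.of_forall fun k => hgK _ (mem_range_self t))
  have hpos : 0 < l₀ := by
    rw [pos_iff_ne_zero]
    rintro rfl
    have := hη.dist_le_mul 0 1
    rw [h0, h1, NNReal.coe_zero, zero_mul] at this
    exact hne (dist_le_zero.1 this)
  have hcut : ∀ s t : unitInterval, s < t → η s ≠ η t := by
    intro s t hst heq
    obtain ⟨c, ζ, hc, hζ, hζ0, hζ1, hζr⟩ := exists_lipschitz_cut hη hst heq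
    have hle : sInf A ≤ l₀ * c :=
      csInf_le (OrderBot.bddBelow A) ⟨ζ, hζ, hζ0.trans h0, hζ1.trans h1, hζr.trans hηK⟩
    rw [← hmin] at hle
    exact absurd hle (not_le.2 (mul_lt_of_lt_one_right hpos hc))
  refine ⟨l₀, η, hη, h0, h1, hηK, fun s t hst => ?_⟩
  by_contra hne'
  rcases lt_or_gt_of_ne hne' with h | h
  · exact hcut s t h hst
  · exact hcut t s h hst.symm

variable [MeasurableSpace X] [BorelSpace X]

/-- An injective Lipschitz path can be parametrized proportionally to its length. -/
theorem exists_lipschitzWith_hausdorffMeasure_range_of_injective {C : ℝ≥0}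
    {γ : unitInterval → X} (hγ : LipschitzWith C γ) (hinj : Function.Injective γ) :
    ∃ η : unitInterval → X, LipschitzWith (Measure.hausdorffMeasure 1 (range γ)).toNNReal η ∧
      η 0 = γ 0 ∧ η 1 = γ 1 ∧ range η = range γ := by
  let m : Set unitInterval → ℝ≥0∞ := fun s => Measure.hausdorffMeasure 1 (γ '' s)
  have hfin : ∀ s, m s ≠ ∞ := fun s =>
    (((measure_mono (image_subset_range γ s)).trans
      hγ.hausdorffMeasure_one_range_le).trans_lt ENNReal.coe_lt_top).ne
  let φ : unitInterval → ℝ := fun t => (m (Iic t)).toReal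
  have hadd : ∀ s t, s ≤ t → φ t - φ s = (m (Icc s t)).toReal := by
    intro s t hst
    have hmeas : MeasurableSet (γ '' Ioc s t) := by
      have : γ '' Ioc s t = γ '' Icc s t \ {γ s} := by
        rw [← Icc_sdiff_left, image_sdiff hinj, image_singleton]
      rw [this]
      exact (isCompact_Icc.image hγ.continuous).measurableSet.diff (measurableSet_singleton _)
    have e1 : m (Iic t) = m (Iic s) + m (Ioc s t) := by
      change Measure.hausdorffMeasure 1 (γ '' _) = _
      rw [← Iic_union_Ioc_eq_Iic hst, image_union, measure_union _ hmeas]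
      rw [disjoint_image_iff hinj]
      exact Iic_disjoint_Ioc le_rfl
    have e2 : m (Icc s t) = m (Ioc s t) := by
      have := Measure.nullSingletonClass_hausdorff X (d := 1) zero_lt_one
      change Measure.hausdorffMeasure 1 (γ '' _) = _
      rw [← Ioc_insert_left hst, image_insert_eq, measure_congr (insert_ae_eq_self _ _)]
    rw [e2]
    change (m (Iic t)).toReal - (m (Iic s)).toReal = _
    rw [e1, ENNReal.toReal_add (hfin _) (hfin _), add_sub_cancel_left]
  have hle : ∀ s t, dist (γ s) (γ t) ≤ |φ s - φ t| := by
    have key : ∀ s t, s ≤ t → dist (γ s) (γ t) ≤ φ t - φ s := by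
      intro s t hst
      rw [hadd s t hst, dist_edist]
      refine ENNReal.toReal_mono (hfin _) ?_
      exact (isPreconnected_Icc.image γ hγ.continuous.continuousOn).edist_le_hausdorffMeasure
        (mem_image_of_mem _ (left_mem_Icc.2 hst)) (mem_image_of_mem _ (right_mem_Icc.2 hst))
    intro s t
    rcases le_total s t with h | h
    · rw [abs_sub_comm]
      exact (key s t h).trans (le_abs_self _)
    · rw [dist_comm]
      exact (key t s h).trans (le_abs_self _)
  have hlip : LipschitzWith C φ := by
    have key : ∀ s t, s ≤ t → dist (φ s) (φ t) ≤ C * dist s t := by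
      intro s t hst
      have hd := hadd s t hst
      rw [dist_comm, Real.dist_eq, hd, abs_of_nonneg ENNReal.toReal_nonneg]
      have h1 := hγ.hausdorffMeasure_one_image_le (Icc s t)
      rw [hausdorffMeasure_unitInterval_Icc hst] at h1
      have h2 := ENNReal.toReal_mono (ENNReal.mul_ne_top ENNReal.coe_ne_top (edist_ne_top _ _)) h1
      rwa [ENNReal.toReal_mul, ENNReal.coe_toReal, ← dist_edist] at h2
    refine LipschitzWith.of_dist_le_mul fun s t => ?_
    rcases le_total s t with h | h
    · exact key s t h
    · rw [dist_comm, dist_comm s]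
      exact key t s h
  have hφ0 : φ 0 = 0 := by
    have := hadd 0 0 le_rfl
    have h0 : m (Icc 0 0) = m (Iic 0) := by
      congr 1
      ext t
      simp
    rw [h0, sub_self] at this
    exact this.symm
  set M := (Measure.hausdorffMeasure 1 (range γ)).toNNReal
  have hφ1 : φ 1 = M := by
    have h1 : (Iic (1 : unitInterval)) = univ := Iic_top
    change (Measure.hausdorffMeasure 1 (γ '' Iic 1)).toReal = _
    rw [h1, image_univ]
    rfl
  have hsurj : ∀ u : unitInterval, ∃ t, φ t = M * u := by
    intro u
    have := intermediate_value_univ (0 : unitInterval) 1 hlip.continuous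
    rw [hφ0, hφ1] at this
    exact this ⟨mul_nonneg M.coe_nonneg u.2.1, mul_le_of_le_one_right M.coe_nonneg u.2.2⟩
  choose ψ hψ using hsurj
  have heq : ∀ (u : unitInterval) t, φ t = M * u → γ (ψ u) = γ t := by
    intro u t h
    have := hle (ψ u) t
    rw [hψ, h, sub_self, abs_zero] at this
    exact dist_le_zero.1 this
  refine ⟨fun u => γ (ψ u), ?_, heq 0 0 (by simp [hφ0]), heq 1 1 (by simp [hφ1]), ?_⟩
  · refine LipschitzWith.of_dist_le_mul fun u v => (hle _ _).trans (le_of_eq ?_)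
    rw [hψ, hψ, ← mul_sub, abs_mul, NNReal.abs_eq, Subtype.dist_eq, Real.dist_eq]
  · refine Subset.antisymm (by rintro _ ⟨u, rfl⟩; exact mem_range_self _) ?_
    rintro _ ⟨t, rfl⟩
    have hmono : φ t ≤ M := by
      rw [← hφ1]
      have := hadd t 1 t.2.2
      have h0 : 0 ≤ (m (Icc t 1)).toReal := ENNReal.toReal_nonneg
      linarith
    have h0 : 0 ≤ φ t := ENNReal.toReal_nonneg
    refine ⟨⟨φ t / M, div_nonneg h0 M.coe_nonneg, div_le_one_of_le₀ hmono M.coe_nonneg⟩, heq _ _ ?_⟩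
    change φ t = M * (φ t / M)
    rcases eq_or_ne (M : ℝ) 0 with hM0 | hM0
    · rw [hM0, zero_mul]
      exact le_antisymm (hM0 ▸ hmono) h0
    · exact (mul_div_cancel₀ (φ t) hM0).symm

/-- The image of a Lipschitz path contains a path with the same end points whose Lipschitz constant
is the Hausdorff measure of its image. -/
theorem exists_lipschitzWith_hausdorffMeasure_range {C : ℝ≥0} {γ : unitInterval → X}
    (hγ : LipschitzWith C γ) :
    ∃ η : unitInterval → X, LipschitzWith (Measure.hausdorffMeasure 1 (range η)).toNNReal η ∧
      η 0 = γ 0 ∧ η 1 = γ 1 ∧ range η ⊆ range γ := by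
  by_cases hne : γ 0 = γ 1
  · exact ⟨fun _ => γ 0, (LipschitzWith.const _).weaken zero_le, rfl, hne, by
      rintro _ ⟨t, rfl⟩; exact mem_range_self _⟩
  · obtain ⟨D, ζ, hζ, h0, h1, hr, hinj⟩ :=
      exists_injective_lipschitzWith (isCompact_range hγ.continuous) hγ Subset.rfl hne
    obtain ⟨η, hη, hη0, hη1, hηr⟩ :=
      exists_lipschitzWith_hausdorffMeasure_range_of_injective hζ hinj
    exact ⟨η, hηr ▸ hη, hη0.trans h0, hη1.trans h1, hηr ▸ hr⟩

/-- Golab's lower semicontinuity of length inside open sets, for paths parametrized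
proportionally to length. -/
theorem hausdorffMeasure_range_inter_le_liminf {l : ℕ → ℝ≥0} {l₀ : ℝ≥0}
    {γ : ℕ → unitInterval → X} {γ₀ : unitInterval → X} (hγ : ∀ k, LipschitzWith (l k) (γ k))
    (hl : ∀ k, (l k : ℝ≥0∞) ≤ Measure.hausdorffMeasure 1 (range (γ k)))
    (hlim : Tendsto l atTop (𝓝 l₀)) (hγ₀ : LipschitzWith l₀ γ₀)
    (hu : TendstoUniformly γ γ₀ atTop) {U : Set X} (hU : IsOpen U) :
    Measure.hausdorffMeasure 1 (range γ₀ ∩ U) ≤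
      liminf (fun k => Measure.hausdorffMeasure 1 (range (γ k) ∩ U)) atTop := by
  have hV : IsOpen (γ₀ ⁻¹' U) := hU.preimage hγ₀.continuous
  have h1 : Measure.hausdorffMeasure 1 (range γ₀ ∩ U) ≤
      l₀ * Measure.hausdorffMeasure 1 (γ₀ ⁻¹' U) := by
    rw [inter_comm, ← image_preimage_eq_inter_range]
    exact hγ₀.hausdorffMeasure_one_image_le _
  refine h1.trans ?_
  rw [hV.measure_eq_iSup_isCompact]
  simp only [ENNReal.mul_iSup, iSup_le_iff]
  intro C hCV hC
  have ht : Tendsto (fun k => (l k : ℝ≥0∞) * Measure.hausdorffMeasure 1 C) atTop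
      (𝓝 (l₀ * Measure.hausdorffMeasure 1 C)) :=
    ENNReal.Tendsto.mul_const (ENNReal.tendsto_coe.2 hlim) (Or.inr (measure_ne_top _ _))
  rw [← ht.liminf_eq]
  refine liminf_le_liminf ?_
  obtain ⟨δ, hδ, hthick⟩ := (hC.image hγ₀.continuous).exists_thickening_subset_open hU
    (image_subset_iff.2 hCV)
  filter_upwards [Metric.tendstoUniformly_iff.1 hu δ hδ] with k hk
  have hsub : γ k '' C ⊆ range (γ k) ∩ U := by
    rintro _ ⟨t, ht, rfl⟩
    refine ⟨mem_range_self _, hthick (Metric.mem_thickening_iff.2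
      ⟨γ₀ t, mem_image_of_mem _ ht, ?_⟩)⟩
    rw [dist_comm]
    exact hk t
  refine le_trans ?_ (measure_mono hsub)
  have h2 : (l k : ℝ≥0∞) ≤ Measure.hausdorffMeasure 1 (γ k '' C)
      + l k * Measure.hausdorffMeasure 1 Cᶜ := by
    refine (hl k).trans ?_
    rw [← image_univ, ← union_compl_self C, image_union]
    exact (measure_union_le _ _).trans (by gcongr; exact (hγ k).hausdorffMeasure_one_image_le _)
  have h3 : (l k : ℝ≥0∞) = l k * Measure.hausdorffMeasure 1 C
      + l k * Measure.hausdorffMeasure 1 Cᶜ := by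
    rw [← mul_add, measure_add_measure_compl hC.measurableSet, measure_univ, mul_one]
  have hfin : l k * Measure.hausdorffMeasure 1 Cᶜ ≠ ∞ :=
    ENNReal.mul_ne_top ENNReal.coe_ne_top (measure_ne_top _ _)
  exact (ENNReal.add_le_add_iff_right hfin).1 (h3.symm.trans_le h2)

end Compactness

/-! ### The case of infinite `a` -/

/-- A lower semicontinuity inequality for all superlevel sets of `f` passes to the integral. -/
theorem lintegral_le_liminf_lintegral_of_forall_superlevel {X : Type*} [MeasurableSpace X]
    {μ : Measure X} {μs : ℕ → Measure X} {f : X → ℝ≥0∞} (hf : Measurable f)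
    (h : ∀ c < ∞, μ (f ⁻¹' Ioi c) ≤ liminf (fun k => μs k (f ⁻¹' Ioi c)) atTop) :
    ∫⁻ x, f x ∂μ ≤ liminf (fun k => ∫⁻ x, f x ∂μs k) atTop := by
  have hcap : ∀ N : ℕ, ∫⁻ x, min (f x) N ∂μ ≤ liminf (fun k => ∫⁻ x, f x ∂μs k) atTop := by
    intro N
    have hne : ∀ x, min (f x) (N : ℝ≥0∞) ≠ ∞ := fun x =>
      ((min_le_right _ _).trans_lt (ENNReal.natCast_lt_top N)).ne
    let g : X → ℝ := fun x => (min (f x) (N : ℝ≥0∞)).toReal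
    have hg : Measurable g := (hf.min measurable_const).ennreal_toReal
    have hg0 : 0 ≤ g := fun x => ENNReal.toReal_nonneg
    have hfg : ∀ x, ENNReal.ofReal (g x) = min (f x) N := fun x => ENNReal.ofReal_toReal (hne x)
    have hset : ∀ t ∈ Ioi (0 : ℝ), {x | t < g x} = ∅ ∨
        {x | t < g x} = f ⁻¹' Ioi (ENNReal.ofReal t) := by
      intro t ht
      have hiff : ∀ x, t < g x ↔ ENNReal.ofReal t < f x ∧ ENNReal.ofReal t < N := by
        intro x
        rw [← lt_min_iff, ← ENNReal.ofReal_lt_iff_lt_toReal (le_of_lt ht) (hne x)]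
      by_cases hN : ENNReal.ofReal t < N
      · right
        ext x
        simp [hiff, hN]
      · left
        ext x
        simp [hiff, hN]
    calc ∫⁻ x, min (f x) N ∂μ = ∫⁻ x, ENNReal.ofReal (g x) ∂μ := by simp only [hfg]
      _ = ∫⁻ t in Ioi 0, μ {x | t < g x} :=
        lintegral_eq_lintegral_meas_lt _ (Eventually.of_forall hg0) hg.aemeasurable
      _ ≤ ∫⁻ t in Ioi 0, liminf (fun k => μs k {x | t < g x}) atTop := by
        refine setLIntegral_mono' measurableSet_Ioi fun t ht => ?_
        rcases hset t ht with h0 | h0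
        · simp [h0]
        · rw [h0]
          exact h _ ENNReal.ofReal_lt_top
      _ ≤ liminf (fun k => ∫⁻ t in Ioi 0, μs k {x | t < g x}) atTop :=
        lintegral_liminf_le fun k => Antitone.measurable fun s t hst =>
          measure_mono fun x hx => lt_of_le_of_lt hst hx
      _ = liminf (fun k => ∫⁻ x, ENNReal.ofReal (g x) ∂μs k) atTop := by
        congr 1
        ext k
        exact (lintegral_eq_lintegral_meas_lt _ (Eventually.of_forall hg0) hg.aemeasurable).symm
      _ ≤ _ := by
        refine liminf_le_liminf (Eventually.of_forall fun k => lintegral_mono fun x => ?_)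
        rw [hfg]
        exact min_le_left _ _
  have hsup : ∀ x, f x = ⨆ N : ℕ, min (f x) (N : ℝ≥0∞) := by
    intro x
    rw [← inf_iSup_eq, ENNReal.iSup_natCast, inf_top_eq]
  calc ∫⁻ x, f x ∂μ = ∫⁻ x, ⨆ N : ℕ, min (f x) (N : ℝ≥0∞) ∂μ := lintegral_congr hsup
    _ = ⨆ N : ℕ, ∫⁻ x, min (f x) (N : ℝ≥0∞) ∂μ :=
      lintegral_iSup (fun N => hf.min measurable_const) fun i j hij x =>
        min_le_min_left _ (Nat.cast_le.2 hij)
    _ ≤ _ := iSup_le hcap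

/-- If lower semicontinuity of a sequence of measures `μs k ≤ ν` holds on open sets, it holds on
complements of sets of finite `ν`-measure. -/
theorem measure_compl_le_liminf_of_forall_isOpen {X : Type*} [PseudoMetricSpace X]
    [MeasurableSpace X] [BorelSpace X] {μ ν : Measure X} {μs : ℕ → Measure X}
    (hν : ∀ k, μs k ≤ ν) (h : ∀ U, IsOpen U → μ U ≤ liminf (fun k => μs k U) atTop)
    {A : Set X} (hA : MeasurableSet A) (hfin : ν A < ∞) :
    μ Aᶜ ≤ liminf (fun k => μs k Aᶜ) atTop := by
  refine ENNReal.le_of_forall_pos_le_add fun ε hε _ => ?_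
  have : IsFiniteMeasure (ν.restrict A) := ⟨by rwa [Measure.restrict_apply_univ]⟩
  obtain ⟨F, hFA, hF, hlt⟩ := hA.exists_isClosed_sdiff_lt (μ := ν.restrict A) (measure_ne_top _ _)
    (ENNReal.coe_pos.2 hε).ne'
  rw [Measure.restrict_apply (hA.diff hF.measurableSet),
    inter_eq_left.2 sdiff_subset] at hlt
  calc μ Aᶜ ≤ μ Fᶜ := measure_mono (compl_subset_compl.2 hFA)
    _ ≤ liminf (fun k => μs k Fᶜ) atTop := h _ hF.isOpen_compl
    _ ≤ liminf (fun k => μs k Aᶜ + ε) atTop := by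
      refine liminf_le_liminf (Eventually.of_forall fun k => ?_)
      calc μs k Fᶜ ≤ μs k (Aᶜ ∪ (A \ F)) := measure_mono fun x hx => by
            by_cases hxA : x ∈ A
            · exact Or.inr ⟨hxA, hx⟩
            · exact Or.inl hxA
        _ ≤ μs k Aᶜ + μs k (A \ F) := measure_union_le _ _
        _ ≤ μs k Aᶜ + ε := by
          gcongr
          exact (hν k _).trans hlt.le
    _ = liminf (fun k => μs k Aᶜ) atTop + ε :=
      liminf_add_const atTop _ _ (by isBoundedDefault) (by isBoundedDefault)

section InfiniteCost

variable {n : ℕ} {Ω S : Set (EuclideanSpace ℝ (Fin n))} {b : EuclideanSpace ℝ (Fin n) → ℝ≥0∞}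

/-- The density that equals `b` on `S` and `∞` off `S`. -/
noncomputable def topOff (S : Set (EuclideanSpace ℝ (Fin n)))
    (b : EuclideanSpace ℝ (Fin n) → ℝ≥0∞) (z : EuclideanSpace ℝ (Fin n)) : ℝ≥0∞ :=
  open Classical in if z ∈ S then b z else ∞

theorem topOff_preimage_Ioi {c : ℝ≥0∞} (hc : c < ∞) :
    topOff S b ⁻¹' Ioi c = {z ∈ S | b z ≤ c}ᶜ := by
  ext z
  by_cases hz : z ∈ S <;> simp [topOff, hz, hc]

theorem measurableSet_sublevel (hS : MeasurableSet S) (hb : LowerSemicontinuousOn b S)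
    (c : ℝ≥0∞) : MeasurableSet {z ∈ S | b z ≤ c} := by
  obtain ⟨u, hu, h⟩ := lowerSemicontinuousOn_iff_preimage_Ioi.1 hb c
  have : {z ∈ S | b z ≤ c} = S \ (S ∩ u) := by
    rw [← h]
    ext z
    simp only [mem_ofPred_eq, Set.mem_sdiff, mem_inter_iff, mem_preimage, mem_Ioi, not_and, not_lt]
    tauto
  rw [this]
  exact hS.diff (hS.inter hu.measurableSet)

theorem measurable_topOff (hS : MeasurableSet S) (hb : LowerSemicontinuousOn b S) :
    Measurable (topOff S b) := by
  refine measurable_of_Ioi fun c => ?_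
  rcases eq_or_ne c ∞ with rfl | hc
  · simp
  · rw [topOff_preimage_Ioi hc.lt_top]
    exact (measurableSet_sublevel hS hb c).compl

theorem travelCost_top (hS : MeasurableSet S) {T : Set (EuclideanSpace ℝ (Fin n))}
    (hT : MeasurableSet T) :
    travelCost S ∞ b T = ∫⁻ z in T, topOff S b z ∂(Measure.hausdorffMeasure 1) := by
  rw [← lintegral_inter_add_sdiff _ T hS]
  unfold travelCost
  congr 1
  · refine setLIntegral_congr_fun (hT.inter hS) fun z hz => ?_
    simp [topOff, hz.2]
  · rw [← setLIntegral_const]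
    refine setLIntegral_congr_fun (hT.diff hS) fun z hz => ?_
    simp [topOff, hz.2]

theorem hausdorffMeasure_le_sublevel_add_travelCost (hS : MeasurableSet S)
    (hb : LowerSemicontinuousOn b S) {T : Set (EuclideanSpace ℝ (Fin n))} (hT : MeasurableSet T) :
    Measure.hausdorffMeasure 1 T ≤
      Measure.hausdorffMeasure 1 {z ∈ S | b z ≤ 1} + travelCost S ∞ b T := by
  have h1 : T ⊆ {z ∈ S | b z ≤ 1} ∪ (T ∩ topOff S b ⁻¹' Ioi 1) := by
    intro z hz
    rw [topOff_preimage_Ioi ENNReal.one_lt_top]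
    by_cases h : z ∈ {z ∈ S | b z ≤ 1}
    · exact Or.inl h
    · exact Or.inr ⟨hz, h⟩
  refine (measure_mono h1).trans ((measure_union_le _ _).trans ?_)
  gcongr
  have hm := measurable_topOff hS hb measurableSet_Ioi (t := Ioi 1)
  rw [travelCost_top hS hT, ← setLIntegral_one]
  calc _ ≤ ∫⁻ z in T ∩ topOff S b ⁻¹' Ioi 1, topOff S b z ∂(Measure.hausdorffMeasure 1) :=
        setLIntegral_mono' (hT.inter hm) fun z hz => le_of_lt hz.2
    _ ≤ _ := lintegral_mono_set inter_subset_left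

theorem travelCost_range_le_liminf (hS : MeasurableSet S) (hb : LowerSemicontinuousOn b S)
    (hfin : FiniteSublevels S ∞ b) {l : ℕ → ℝ≥0} {l₀ : ℝ≥0}
    {γ : ℕ → unitInterval → EuclideanSpace ℝ (Fin n)}
    {γ₀ : unitInterval → EuclideanSpace ℝ (Fin n)} (hγ : ∀ k, LipschitzWith (l k) (γ k))
    (hl : ∀ k, (l k : ℝ≥0∞) ≤ Measure.hausdorffMeasure 1 (range (γ k)))
    (hlim : Tendsto l atTop (𝓝 l₀)) (hγ₀ : LipschitzWith l₀ γ₀)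
    (hu : TendstoUniformly γ γ₀ atTop) :
    travelCost S ∞ b (range γ₀) ≤ liminf (fun k => travelCost S ∞ b (range (γ k))) atTop := by
  have hm : ∀ {K : ℝ≥0} {η : unitInterval → EuclideanSpace ℝ (Fin n)},
      LipschitzWith K η → MeasurableSet (range η) :=
    fun h => (isCompact_range h.continuous).measurableSet
  simp only [travelCost_top hS (hm (hγ _)), travelCost_top hS (hm hγ₀)]
  refine lintegral_le_liminf_lintegral_of_forall_superlevel (measurable_topOff hS hb) fun c hc => ?_
  rw [topOff_preimage_Ioi hc]
  refine measure_compl_le_liminf_of_forall_isOpen (ν := Measure.hausdorffMeasure 1)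
    (fun k => Measure.restrict_le_self) (fun U hU => ?_) (measurableSet_sublevel hS hb c)
    (hfin c hc)
  simp only [Measure.restrict_apply hU.measurableSet, inter_comm U]
  exact hausdorffMeasure_range_inter_le_liminf hγ hl hlim hγ₀ hu hU

theorem lowerSemicontinuousOn_urbanMetric (hΩ : IsClosed Ω) (hS : MeasurableSet S)
    (hb : LowerSemicontinuousOn b S) (hfin : FiniteSublevels S ∞ b) :
    LowerSemicontinuousOn
      (fun p : EuclideanSpace ℝ (Fin n) × EuclideanSpace ℝ (Fin n) =>
        urbanMetric Ω S ∞ b p.1 p.2) (Ω ×ˢ Ω) := by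
  rintro ⟨x, y⟩ - c hc
  obtain ⟨c', hcc', hc'⟩ := exists_between hc
  by_contra hcon
  have hfreq : ∃ᶠ p in 𝓝 (x, y), urbanMetric Ω S ∞ b p.1 p.2 ≤ c := by
    rw [not_eventually] at hcon
    exact (hcon.mono fun p hp => not_lt.1 hp).filter_mono nhdsWithin_le_nhds
  obtain ⟨p, hp, hpc⟩ := exists_seq_forall_of_frequently hfreq
  have hpath : ∀ k, ∃ η : unitInterval → EuclideanSpace ℝ (Fin n),
      LipschitzWith (Measure.hausdorffMeasure 1 (range η)).toNNReal η ∧ (∀ t, η t ∈ Ω) ∧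
      η 0 = (p k).1 ∧ η 1 = (p k).2 ∧ travelCost S ∞ b (range η) ≤ c' := by
    intro k
    have := (hpc k).trans_lt hcc'
    simp only [urbanMetric, iInf_lt_iff] at this
    obtain ⟨γ, ⟨⟨K, hK⟩, hγΩ, h0, h1⟩, hcost⟩ := this
    obtain ⟨η, hη, hη0, hη1, hr⟩ := exists_lipschitzWith_hausdorffMeasure_range hK
    refine ⟨η, hη, fun t => ?_, hη0.trans h0, hη1.trans h1, (travelCost_mono hr).trans hcost.le⟩
    obtain ⟨u, hu⟩ := hr (mem_range_self t)
    exact hu ▸ hγΩ u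
  choose η hη hηΩ hη0 hη1 hcost using hpath
  have hbd : ∀ k, Measure.hausdorffMeasure 1 (range (η k)) ≤
      Measure.hausdorffMeasure 1 {z ∈ S | b z ≤ 1} + c' := fun k =>
    (hausdorffMeasure_le_sublevel_add_travelCost hS hb
      (isCompact_range (hη k).continuous).measurableSet).trans (by gcongr; exact hcost k)
  have hbd_top : Measure.hausdorffMeasure 1 {z ∈ S | b z ≤ 1} + c' ≠ ∞ :=
    ENNReal.add_ne_top.2 ⟨(hfin 1 ENNReal.one_lt_top).ne, (hc'.trans_le le_top).ne⟩
  set L := (Measure.hausdorffMeasure 1 {z ∈ S | b z ≤ 1} + c').toNNReal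
  have hlL : ∀ k, (Measure.hausdorffMeasure 1 (range (η k))).toNNReal ≤ L := fun k =>
    ENNReal.toNNReal_mono hbd_top (hbd k)
  have hbounded : Bornology.IsBounded (⋃ k, range (η k)) := by
    have hp1 : Tendsto (fun k => (p k).1) atTop (𝓝 x) := (continuous_fst.tendsto _).comp hp
    obtain ⟨R, hR⟩ := (Metric.isBounded_range_of_tendsto _ hp1).subset_closedBall x
    refine (Metric.isBounded_closedBall (x := x) (r := L + R)).subset ?_
    refine iUnion_subset fun k => ?_
    rintro _ ⟨t, rfl⟩
    have h1 : dist (η k t) (η k 0) ≤ L := by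
      refine (((hη k).weaken (hlL k)).dist_le_mul t 0).trans ?_
      refine mul_le_of_le_one_right L.coe_nonneg ?_
      rw [Subtype.dist_eq, Real.dist_eq, Icc.coe_zero, sub_zero, abs_of_nonneg t.2.1]
      exact t.2.2
    have h2 : dist (η k 0) x ≤ R := by
      rw [hη0]
      exact hR (mem_range_self k)
    exact (dist_triangle _ _ _).trans (add_le_add h1 h2)
  obtain ⟨φ, l₀, γ₀, hφ, hlim, hγ₀, hu⟩ := exists_subseq_tendstoUniformly_lipschitzWith
    hbounded.isCompact_closure hlL hη
    (fun k t => subset_closure (mem_iUnion.2 ⟨k, mem_range_self t⟩))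
  have hpφ : Tendsto (p ∘ φ) atTop (𝓝 (x, y)) := hp.comp hφ.tendsto_atTop
  have hmem : γ₀ ∈ lipschitzPaths Ω x y := by
    refine ⟨⟨l₀, hγ₀⟩, fun t => hΩ.mem_of_tendsto (hu.tendsto_at t)
      (Eventually.of_forall fun k => hηΩ _ t), ?_, ?_⟩
    · refine tendsto_nhds_unique (hu.tendsto_at 0) ?_
      simp only [hη0]
      exact (continuous_fst.tendsto _).comp hpφ
    · refine tendsto_nhds_unique (hu.tendsto_at 1) ?_
      simp only [hη1]
      exact (continuous_snd.tendsto _).comp hpφ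
  have hle := travelCost_range_le_liminf hS hb hfin (fun k => hη (φ k))
    (fun k => ENNReal.coe_toNNReal_le_self) hlim hγ₀ hu
  have hle' : travelCost S ∞ b (range γ₀) ≤ c' :=
    hle.trans ((liminf_le_liminf (Eventually.of_forall fun k => hcost (φ k))).trans
      (by rw [liminf_const]))
  exact absurd ((iInf₂_le γ₀ hmem).trans hle') (not_le.2 hc')

end InfiniteCost

theorem mainTheorem8 (n : ℕ) (Ω S : Set (EuclideanSpace ℝ (Fin n)))
    (hΩ_closed : IsClosed Ω) (hΩ_convex : Convex ℝ Ω)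
    (hSΩ : S ⊆ Ω) (hS_rect : IsCountablyOneRectifiable S) (hS_borel : MeasurableSet S)
    (a : ℝ≥0∞) (b : EuclideanSpace ℝ (Fin n) → ℝ≥0∞)
    (hb_lsc : LowerSemicontinuousOn b S) (hba : ∀ z ∈ S, b z ≤ a) :
    (a < ∞ →
      ContinuousOn
        (fun p : EuclideanSpace ℝ (Fin n) × EuclideanSpace ℝ (Fin n) =>
          urbanMetric Ω S a b p.1 p.2) (Ω ×ˢ Ω)) ∧
    (a = ∞ → FiniteSublevels S a b →
      LowerSemicontinuousOn
        (fun p : EuclideanSpace ℝ (Fin n) × EuclideanSpace ℝ (Fin n) =>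
          urbanMetric Ω S a b p.1 p.2) (Ω ×ˢ Ω)) := by
  refine ⟨continuousOn_urbanMetric hΩ_convex hS_borel hba, ?_⟩
  rintro rfl hfin
  exact lowerSemicontinuousOn_urbanMetric hΩ_closed hS_borel hb_lsc hfin
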